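/- All graphs are finite, undirected and simple. For a graph $G$, let $n_o(G)$ denote the number of vertices of odd degree in $G$. A path decomposition of $G$ is a collection of pairwise edge-disjoint paths of $G$ that covers all the edges of $G$, and $p(G)$ denotes the minimum number of paths in a path decomposition of $G$. Let $P_m$ be the path with $m$ vertices, and let $G\,\Box\,H$ be the Cartesian product of $G$ and $H$, that is, the graph with vertex set $V(G)\times V(H)$ in which $(u_1,v_1)$ and $(u_2,v_2)$ are adjacent if and only if either $u_1u_2\in E(G)$ and $v_1=v_2$, or $v_1v_2\in E(H)$ and $u_1=u_2$. **Theorem 5.3.** Let $H$ be a graph (not necessarily connected) with $n$ vertices in which every vertex has even degree. Then for every integer $m\ge 2$, $$p(P_m\,\Box\,H)=\frac{n_o(P_m\,\Box\,H)}{2}=n.$$ -/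

import Mathlib

namespace SimpleGraph

variable {V : Type*}

/-- A subgraph of `G` is a path of `G` if it consists of the vertices and edges traversed by a walk
without repeated vertices. -/
def Subgraph.IsPathSubgraph {G : SimpleGraph V} (P : G.Subgraph) : Prop :=
  ∃ (u v : V) (w : G.Walk u v), w.IsPath ∧ P = w.toSubgraph

/-- A path decomposition of `G`: a finite collection of pairwise edge-disjoint paths of `G` that
together cover all the edges of `G`. -/
structure IsPathDecomposition (G : SimpleGraph V) (D : Finset G.Subgraph) : Prop where
  isPath : ∀ P ∈ D, P.IsPathSubgraph
  edgeDisjoint : ∀ P ∈ D, ∀ Q ∈ D, P ≠ Q → Disjoint P.edgeSet Q.edgeSet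
  covers : ∀ e ∈ G.edgeSet, ∃ P ∈ D, e ∈ P.edgeSet

/-- The path number `p(G)`: the least number of paths in a path decomposition of `G`. (For finite
`G` the minimum is attained, see `exists_isPathDecomposition_card_eq_pathNumber`.) -/
noncomputable def pathNumber (G : SimpleGraph V) : ℕ :=
  sInf {k : ℕ | ∃ D : Finset G.Subgraph, G.IsPathDecomposition D ∧ D.card = k}

open Classical in
/-- The number `n_o(G)` of vertices of odd degree of a finite graph `G`. -/
noncomputable def numOddVertices [Fintype V] (G : SimpleGraph V) : ℕ :=
  (Finset.univ.filter fun v : V => Odd (G.degree v)).card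

/-- A finite graph has a path decomposition: take its single edges. -/
theorem exists_isPathDecomposition [Finite V] (G : SimpleGraph V) :
    ∃ D : Finset G.Subgraph, G.IsPathDecomposition D := by
  classical
  have key : ∀ e ∈ G.edgeSet, ∃ P : G.Subgraph, P.IsPathSubgraph ∧ P.edgeSet = {e} := by
    intro e
    induction e using Sym2.ind with
    | _ u v =>
      intro h
      have h' : G.Adj u v := h
      exact ⟨G.subgraphOfAdj h',
        ⟨u, v, h'.toWalk, Walk.IsPath.of_adj h', by
          simp [Walk.toSubgraph]⟩, by simp⟩
  choose! f hf1 hf2 using key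
  have hfin : G.edgeSet.Finite := Set.toFinite _
  refine ⟨hfin.toFinset.image f, ?_, ?_, ?_⟩
  · intro P hP
    simp only [Finset.mem_image, Set.Finite.mem_toFinset] at hP
    obtain ⟨e, he, rfl⟩ := hP
    exact hf1 e he
  · intro P hP Q hQ hne
    simp only [Finset.mem_image, Set.Finite.mem_toFinset] at hP hQ
    obtain ⟨e, he, rfl⟩ := hP
    obtain ⟨e', he', rfl⟩ := hQ
    rw [hf2 e he, hf2 e' he', Set.disjoint_singleton]
    rintro rfl
    exact hne rfl
  · intro e he
    refine ⟨f e, ?_, ?_⟩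
    · simp only [Finset.mem_image, Set.Finite.mem_toFinset]
      exact ⟨e, he, rfl⟩
    · rw [hf2 e he]
      exact Set.mem_singleton e

/-- The minimum in the definition of the path number of a finite graph is attained. -/
theorem exists_isPathDecomposition_card_eq_pathNumber [Finite V] (G : SimpleGraph V) :
    ∃ D : Finset G.Subgraph, G.IsPathDecomposition D ∧ D.card = G.pathNumber := by
  obtain ⟨D, h⟩ := G.exists_isPathDecomposition
  exact Nat.sInf_mem (s := {k : ℕ | ∃ D : Finset G.Subgraph,
    G.IsPathDecomposition D ∧ D.card = k}) ⟨_, D, h, rfl⟩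

end SimpleGraph

/-! Lower bound: a path has an even number of edges at every vertex other than its two ends, so each
vertex of odd degree is an end of some path of a decomposition, and a path has at most two ends
(`numOddVertices_le`). In the product, degrees add and those of `H` are even, so the odd vertices
are those of the first and last copies of `H`, twice `Fintype.card V` in all.

Upper bound: the edges of `H` split into paths, trivial ones allowed, such that every vertex is an
end exactly twice; a trivial path counts as two ends at its vertex. `hasPaths_of_parity` proves this
by induction on the number of edges, together with a version for two odd vertices, which are then
ends once. Its main step is `exists_add_edge`, which inserts an edge `ax` and moves one path end
from `x` to `a`, without a new path.

Regard these paths as edges, possibly loops, of a 2-regular multigraph. A balanced orientation makes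
every vertex a start once and a finish once, so there is a permutation `σ` and a path `P v` from `v`
to `σ v` for each `v` (`exists_paths_perm`). Follow `P v` in the first copy of `H`, cross to the
next copy at `σ v`, follow `P (σ v)` there, and so on. As `σ` is a permutation, these lists, one for
each `v`, use every path in every copy and every crossing edge exactly once. -/

namespace PathLists

/-! ### Paths as vertex lists, with multisets of edges and ends -/

variable {V : Type*}

/-- The first entry of a list, as a multiset with at most one element. -/
def firstOf (l : List V) : Multiset V := (l.head?.toList : Multiset V)

/-- The edges joining consecutive entries of a list. -/
def pathEdges : List V → Multiset (Sym2 V)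
  | [] => 0
  | h :: t => (firstOf t).map (fun v => s(h, v)) + pathEdges t

/-- The first and the last entry of a list. -/
def ends (l : List V) : Multiset V := firstOf l + firstOf l.reverse

/-- All edges of a collection of lists. -/
def allEdges (D : Multiset (List V)) : Multiset (Sym2 V) := (D.map pathEdges).sum

/-- All end vertices of a collection of lists. -/
def allEnds (D : Multiset (List V)) : Multiset V := (D.map ends).sum

@[simp] lemma firstOf_nil : firstOf ([] : List V) = 0 := rfl
@[simp] lemma firstOf_cons (h : V) (t : List V) : firstOf (h :: t) = {h} := rfl
@[simp] lemma pathEdges_nil : pathEdges ([] : List V) = 0 := rfl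
@[simp] lemma pathEdges_cons (h : V) (t : List V) :
    pathEdges (h :: t) = (firstOf t).map (fun v => s(h, v)) + pathEdges t := rfl
@[simp] lemma allEdges_zero : allEdges (0 : Multiset (List V)) = 0 := rfl
@[simp] lemma allEnds_zero : allEnds (0 : Multiset (List V)) = 0 := rfl
@[simp] lemma allEdges_cons (l : List V) (D) : allEdges (l ::ₘ D) = pathEdges l + allEdges D := by
  simp [allEdges]
@[simp] lemma allEnds_cons (l : List V) (D) : allEnds (l ::ₘ D) = ends l + allEnds D := by
  simp [allEnds]
@[simp] lemma allEdges_add (C D : Multiset (List V)) :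
    allEdges (C + D) = allEdges C + allEdges D := by
  simp [allEdges]
@[simp] lemma allEnds_add (C D : Multiset (List V)) :
    allEnds (C + D) = allEnds C + allEnds D := by
  simp [allEnds]

lemma ends_reverse (l : List V) : ends l.reverse = ends l := by
  simp [ends, add_comm]

lemma firstOf_append_cons (p q : List V) (a : V) :
    firstOf (p ++ a :: q) = firstOf (p ++ [a]) := by
  cases p <;> simp

lemma mem_of_mem_firstOf {l : List V} {v : V} (h : v ∈ firstOf l) : v ∈ l := by
  cases l <;> simp_all

lemma exists_cons_of_mem_firstOf {l : List V} {v : V} (h : v ∈ firstOf l) : ∃ t, l = v :: t := by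
  cases l <;> simp_all

lemma pathEdges_reverse_append_cons (p q : List V) (a : V) :
    pathEdges (p.reverse ++ a :: q) =
      pathEdges p + (firstOf p).map (fun v => s(a, v)) +
        ((firstOf q).map (fun v => s(a, v)) + pathEdges q) := by
  induction p generalizing a q with
  | nil => simp
  | cons h t ih =>
    have : (h :: t).reverse ++ a :: q = t.reverse ++ h :: (a :: q) := by simp
    rw [this, ih]
    simp only [pathEdges_cons, firstOf_cons, Multiset.map_singleton, Sym2.eq_swap (a := h) (b := a)]
    abel

lemma pathEdges_reverse (l : List V) : pathEdges l.reverse = pathEdges l := by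
  cases l with
  | nil => rfl
  | cons h t =>
    have := pathEdges_reverse_append_cons t [] h
    simp only [List.reverse_cons, this, pathEdges_cons]
    simp [add_comm]

lemma pathEdges_append (p q : List V) :
    pathEdges (p ++ q) = pathEdges p +
      ((firstOf p.reverse).bind fun a => (firstOf q).map fun v => s(a, v)) + pathEdges q := by
  rcases List.eq_nil_or_concat p with rfl | ⟨t, a, rfl⟩
  · simp
  · have h1 := pathEdges_reverse_append_cons t.reverse q a
    have h2 := pathEdges_reverse_append_cons t.reverse [] a
    simp only [List.reverse_reverse] at h1 h2
    have : t.concat a ++ q = t ++ a :: q := by simp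
    rw [this, h1, List.concat_eq_append, h2]
    simp
    abel

lemma mem_of_mem_pathEdges {l : List V} {u v : V} (h : s(u, v) ∈ pathEdges l) : u ∈ l ∧ v ∈ l := by
  induction l with
  | nil => simp at h
  | cons a t ih =>
    rcases Multiset.mem_add.1 h with h | h
    · obtain ⟨w, hw, he⟩ := Multiset.mem_map.1 h
      have := mem_of_mem_firstOf hw
      rcases Sym2.eq_iff.1 he with ⟨rfl, rfl⟩ | ⟨rfl, rfl⟩ <;> simp [this]
    · exact ⟨List.mem_cons_of_mem _ (ih h).1, List.mem_cons_of_mem _ (ih h).2⟩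

/-! ### Inserting an edge by flipping arms -/

/-- Following arms from `x`, from the far end of an arm to its near end, leads to a vertex of `N`. -/
lemma exists_alternating {α : Type*} [DecidableEq α] (A : Finset α) (near far : α → Multiset V)
    (hnear : ∀ l ∈ A, ∃ y, near l = {y}) (x : V)
    (hnodup : (x ::ₘ ∑ l ∈ A, near l).Nodup) (N : Set V)
    (hN : ∀ v ∈ x ::ₘ ∑ l ∈ A, near l, v ∈ N ∨ ∃ l ∈ A, far l = {v}) :
    ∃ S ⊆ A, ∃ y ∈ N, x ::ₘ ∑ l ∈ S, near l = y ::ₘ ∑ l ∈ S, far l := by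
  classical
  -- Keeping `y` among `x` and the near ends makes `hN` applicable to it, so a maximal `S` can stop
  -- only in `N`.
  let good : Finset α → Prop := fun S => ∃ y ∈ x ::ₘ ∑ l ∈ A, near l,
    x ::ₘ ∑ l ∈ S, near l = y ::ₘ ∑ l ∈ S, far l
  have hne : (A.powerset.filter good).Nonempty :=
    ⟨∅, by simp [good]⟩
  obtain ⟨S, hS, hmax⟩ := Finset.exists_max_image _ Finset.card hne
  simp only [Finset.mem_filter, Finset.mem_powerset] at hS hmax
  obtain ⟨hSA, y, hy, hSy⟩ := hS
  refine ⟨S, hSA, y, ?_, hSy⟩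
  by_contra hyN
  obtain ⟨l, hl, hfl⟩ := (hN y hy).resolve_left hyN
  by_cases hlS : l ∈ S
  -- If the arm ending at `y` were already used, `y` would occur twice on the right of `hSy`, while
  -- the left has no repetition.
  · have h1 : (x ::ₘ ∑ l ∈ S, near l).Nodup := by
      refine Multiset.nodup_of_le ?_ hnodup
      exact (Multiset.cons_le_cons_iff x).2 (Finset.sum_le_sum_of_subset hSA)
    rw [hSy, Multiset.nodup_cons] at h1
    apply h1.1
    rw [← Finset.add_sum_erase _ _ hlS, hfl]
    simp
  · obtain ⟨z, hz⟩ := hnear l hl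
    have := hmax (insert l S) ⟨Finset.insert_subset hl hSA, z, ?_, ?_⟩
    · rw [Finset.card_insert_of_notMem hlS] at this
      omega
    · rw [← Finset.add_sum_erase _ _ hl, hz]
      simp
    · rw [Finset.sum_insert hlS, Finset.sum_insert hlS, hz, hfl, Multiset.singleton_add,
        Multiset.singleton_add, Multiset.cons_swap, hSy]

/-- A collection of lists describing (possibly trivial) paths. -/
def IsPaths (D : Multiset (List V)) : Prop := ∀ l ∈ D, l ≠ [] ∧ l.Nodup

/-- Through a vertex `a` with arms `p` and `q`. -/
def through (a : V) (pq : List V × List V) : List V := pq.1.reverse ++ a :: pq.2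

lemma exists_eq_through {l : List V} {a : V} (h : a ∈ l) : ∃ pq, l = through a pq := by
  obtain ⟨s, t, rfl⟩ := List.append_of_mem h
  exact ⟨(s.reverse, t), by simp [through]⟩

lemma nodup_through {a : V} {pq : List V × List V} :
    (through a pq).Nodup ↔ pq.1.Nodup ∧ pq.2.Nodup ∧ a ∉ pq.1 ∧ a ∉ pq.2 ∧
      ∀ v ∈ pq.1, v ∉ pq.2 := by
  rw [through, List.nodup_append']
  simp only [List.nodup_reverse, List.nodup_cons, List.disjoint_left, List.mem_reverse,
    List.mem_cons, not_or]
  grind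

lemma ends_through (a : V) (pq : List V × List V) :
    ends (through a pq) = firstOf (pq.1.reverse ++ [a]) + firstOf (pq.2.reverse ++ [a]) := by
  have : (through a pq).reverse = pq.2.reverse ++ a :: pq.1 := by simp [through]
  rw [ends, this, through, firstOf_append_cons, firstOf_append_cons (p := pq.2.reverse)]

/-- The two arms of all the paths through `a`. -/
def arms (M : Multiset (List V × List V)) : Multiset (List V) := M.map Prod.fst + M.map Prod.snd

/-- An edge of a path through `a` lies inside an arm or joins `a` to the near end of one. The result
depends only on the multiset of arms, not on their pairing, so flips can be accounted for arm by
arm. -/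
lemma allEdges_map_through (a : V) (M : Multiset (List V × List V)) :
    allEdges (M.map (through a)) =
      allEdges (arms M) + (((arms M).map firstOf).sum).map (fun v => s(a, v)) := by
  induction M using Multiset.induction with
  | empty => simp [arms]
  | cons pq M ih =>
    rw [Multiset.map_cons, allEdges_cons, ih]
    simp only [through, pathEdges_reverse_append_cons, arms, Multiset.map_cons, allEdges_add,
      allEdges_cons, Multiset.map_add, Multiset.sum_add, Multiset.sum_cons]
    abel

/-- The appended `a` is the end of the path on the side where the arm is empty; otherwise the far
end of the arm is. -/
lemma allEnds_map_through (a : V) (M : Multiset (List V × List V)) :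
    allEnds (M.map (through a)) = ((arms M).map fun l => firstOf (l.reverse ++ [a])).sum := by
  induction M using Multiset.induction with
  | empty => simp [arms]
  | cons pq M ih =>
    rw [Multiset.map_cons, allEnds_cons, ih]
    simp only [ends_through, arms, Multiset.map_cons,
      Multiset.map_add, Multiset.sum_add, Multiset.sum_cons]
    abel

lemma exists_split (a : V) (D : Multiset (List V)) :
    ∃ (N : Multiset (List V)) (M : Multiset (List V × List V)),
      D = N + M.map (through a) ∧ ∀ l ∈ N, a ∉ l := by
  induction D using Multiset.induction with
  | empty => exact ⟨0, 0, by simp⟩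
  | cons l D ih =>
    obtain ⟨N, M, rfl, hN⟩ := ih
    by_cases h : a ∈ l
    · obtain ⟨pq, rfl⟩ := exists_eq_through h
      exact ⟨N, pq ::ₘ M, by simp, hN⟩
    · refine ⟨l ::ₘ N, M, by simp, ?_⟩
      intro l' hl'
      rcases Multiset.mem_cons.1 hl' with rfl | hl'
      · exact h
      · exact hN _ hl'

lemma nodup_of_nodup_sum_map {α β : Type*} {B : Multiset α} {f : α → Multiset β}
    (hf : ∀ l ∈ B, f l ≠ 0) (h : (B.map f).sum.Nodup) : B.Nodup := by
  rw [Multiset.nodup_iff_ne_cons_cons]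
  rintro l t rfl
  simp only [Multiset.map_cons, Multiset.sum_cons] at h
  obtain ⟨y, hy⟩ := Multiset.exists_mem_of_ne_zero (hf l (by simp))
  rw [Multiset.nodup_add] at h
  exact Multiset.disjoint_left.1 h.2.2 hy (by simp [hy])

lemma sum_map_filter_ne {α β : Type*} [DecidableEq α] [AddCommMonoid β] (A : Multiset α)
    (f : α → β) {b : α} (hf : f b = 0) : ((A.filter (· ≠ b)).map f).sum = (A.map f).sum := by
  induction A using Multiset.induction with
  | empty => simp
  | cons l A ih =>
    by_cases h : l = b
    · subst h; simp [ih, hf]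
    · simp [h, ih]

lemma mem_sum_map {α β : Type*} {A : Multiset α} {f : α → Multiset β} {v : β} :
    v ∈ (A.map f).sum ↔ ∃ l ∈ A, v ∈ f l :=
  Multiset.mem_bind

/-- Reverse the lists that belong to `S`. -/
def flip [DecidableEq V] (S : Finset (List V)) (l : List V) : List V :=
  if l ∈ S then l.reverse else l

section flip
variable [DecidableEq V] (S : Finset (List V))

lemma flip_perm (l : List V) : (flip S l).Perm l := by
  unfold flip
  split_ifs
  · exact l.reverse_perm
  · exact List.Perm.refl _

lemma pathEdges_flip (l : List V) : pathEdges (flip S l) = pathEdges l := by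
  unfold flip
  split_ifs
  · exact pathEdges_reverse l
  · rfl

lemma flip_eq_nil (l : List V) : flip S l = [] ↔ l = [] := by
  unfold flip
  split_ifs <;> simp

/-- Only the terms in `S` change. The identity is stated with sums on both sides to avoid
subtracting multisets. -/
lemma sum_flip {β : Type*} [AddCommMonoid β] {A S : Finset (List V)} (h : S ⊆ A)
    (f : List V → β) :
    ∑ l ∈ A, f (flip S l) + ∑ l ∈ S, f l = ∑ l ∈ A, f l + ∑ l ∈ S, f l.reverse := by
  have h1 : ∑ l ∈ A \ S, f (flip S l) = ∑ l ∈ A \ S, f l := by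
    refine Finset.sum_congr rfl fun l hl => ?_
    rw [flip, if_neg (Finset.mem_sdiff.1 hl).2]
  have h2 : ∑ l ∈ S, f (flip S l) = ∑ l ∈ S, f l.reverse := by
    refine Finset.sum_congr rfl fun l hl => ?_
    rw [flip, if_pos hl]
  rw [← Finset.sum_sdiff h, ← Finset.sum_sdiff h (f := f), h1, h2, add_assoc, add_assoc,
    add_comm (∑ l ∈ S, f l)]

lemma arms_map_flip (M : Multiset (List V × List V)) :
    arms (M.map (Prod.map (flip S) (flip S))) = (arms M).map (flip S) := by
  simp [arms, Multiset.map_map]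

lemma allEdges_map_flip (A : Multiset (List V)) : allEdges (A.map (flip S)) = allEdges A := by
  simp [allEdges, Multiset.map_map, pathEdges_flip]

lemma nodup_through_flip {a : V} {pq : List V × List V} (h : (through a pq).Nodup) :
    (through a (Prod.map (flip S) (flip S) pq)).Nodup := by
  rw [nodup_through] at h ⊢
  simpa only [Prod.map_fst, Prod.map_snd, (flip_perm S _).nodup_iff, (flip_perm S _).mem_iff]
    using h

end flip

lemma firstOf_reverse_append (l : List V) (a : V) :
    firstOf (l.reverse ++ [a]) = firstOf l.reverse + (if l.isEmpty then {a} else 0) := by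
  rcases List.eq_nil_or_concat l with rfl | ⟨t, b, rfl⟩ <;> simp

lemma exists_firstOf_eq {l : List V} (h : l ≠ []) : ∃ y ∈ l, firstOf l = {y} := by
  cases l <;> simp_all

/-- Adding the edge `s(a, x)` to a path decomposition without changing the number of paths. -/
theorem exists_add_edge {D : Multiset (List V)} {a x : V} (hD : IsPaths D) (hax : x ≠ a)
    (hnd : (s(a, x) ::ₘ allEdges D).Nodup) (hends : ∀ v, v ≠ a → v ∈ allEnds D) :
    ∃ D', IsPaths D' ∧ allEdges D' = s(a, x) ::ₘ allEdges D ∧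
      x ::ₘ allEnds D' = a ::ₘ allEnds D := by
  classical
  obtain ⟨N, M, rfl, hN⟩ := exists_split a D
  have hMnd : ∀ pq ∈ M, (through a pq).Nodup := fun pq h =>
    (hD _ (Multiset.mem_add.2 (Or.inr (Multiset.mem_map_of_mem _ h)))).2
  have harm : ∀ l ∈ arms M, a ∉ l := by
    intro l hl
    rcases Multiset.mem_add.1 hl with hl | hl <;>
    obtain ⟨pq, hpq, rfl⟩ := Multiset.mem_map.1 hl <;>
    have := nodup_through.1 (hMnd pq hpq)
    · exact this.2.2.1
    · exact this.2.2.2.1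
  -- Distinct edges at `a` have distinct other ends, so the near ends of the arms differ from each
  -- other and from `x`. In particular nonempty arms are distinct as lists and can be flipped
  -- according to membership in a set.
  have hnd' : (x ::ₘ ((arms M).map firstOf).sum).Nodup := by
    refine Multiset.Nodup.of_map (fun v => s(a, v)) (Multiset.nodup_of_le ?_ hnd)
    rw [Multiset.map_cons, Multiset.cons_le_cons_iff, allEdges_add, allEdges_map_through,
      ← add_assoc]
    exact Multiset.le_add_left _ _
  have hsum : ∀ f : List V → Multiset V, f [] = 0 →
      (((arms M).filter (· ≠ [])).map f).sum = ((arms M).map f).sum :=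
    fun f hf => sum_map_filter_ne _ f hf
  have hBnd : ((arms M).filter (· ≠ [])).Nodup := by
    refine nodup_of_nodup_sum_map (f := firstOf) ?_ ?_
    · intro l hl
      obtain ⟨y, -, hy⟩ := exists_firstOf_eq (Multiset.mem_filter.1 hl).2
      simp [hy]
    · rw [hsum _ firstOf_nil]
      exact (Multiset.nodup_cons.1 hnd').2
  let A : Finset (List V) := ⟨_, hBnd⟩
  have hA : ∀ l ∈ A, l ∈ arms M ∧ l ≠ [] := fun l hl => Multiset.mem_filter.1 hl
  have hsumA : ∀ f : List V → Multiset V, f [] = 0 →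
      ((arms M).map f).sum = ∑ l ∈ A, f l := fun f hf => (hsum f hf).symm
  rw [hsumA _ firstOf_nil] at hnd'
  obtain ⟨S, hSA, y, ⟨l, hlN, hyl⟩, hS⟩ := exists_alternating A firstOf
    (fun l => firstOf l.reverse)
    (fun l hl => by
      obtain ⟨y, -, hy⟩ := exists_firstOf_eq (hA l hl).2
      exact ⟨y, hy⟩) x hnd' {v | ∃ l ∈ N, v ∈ ends l} (by
    intro v hv
    have hva : v ≠ a := by
      rcases Multiset.mem_cons.1 hv with rfl | hv
      · exact hax
      · obtain ⟨l, hl, hvl⟩ := Multiset.mem_sum.1 hv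
        rintro rfl
        exact harm l (hA l hl).1 (mem_of_mem_firstOf hvl)
    have hv' := hends v hva
    rw [allEnds_add, Multiset.mem_add] at hv'
    rcases hv' with hv' | hv'
    · left
      obtain ⟨l, hl, hvm⟩ := mem_sum_map.1 hv'
      exact ⟨l, hl, hvm⟩
    · right
      rw [allEnds_map_through] at hv'
      obtain ⟨l, hl, hvm⟩ := mem_sum_map.1 hv'
      have hne : l ≠ [] := by
        rintro rfl
        simp [hva] at hvm
      refine ⟨l, Multiset.mem_filter.2 ⟨hl, hne⟩, ?_⟩
      obtain ⟨z, -, hz⟩ := exists_firstOf_eq (l := l.reverse) (by simpa using hne)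
      have : firstOf (l.reverse ++ [a]) = {z} := by
        rw [firstOf_reverse_append, hz]
        simp [hne]
      rw [this, Multiset.mem_singleton] at hvm
      rw [hz, hvm])
  -- the lists through `a`, with the arms in `S` flipped
  have hcancel : ∀ f g : List V → Multiset V, f [] = 0 → (∀ l : List V, f l.reverse = g l) →
      ((arms (M.map (Prod.map (flip S) (flip S)))).map f).sum + ∑ l ∈ S, f l =
        ((arms M).map f).sum + ∑ l ∈ S, g l := by
    intro f g hf hg
    have h1 : f (flip S []) = 0 := by rw [(flip_eq_nil S []).2 rfl, hf]
    have := sum_flip hSA f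
    rw [arms_map_flip, Multiset.map_map, hsumA f hf]
    have h2 := hsumA (f ∘ flip S) h1
    rw [h2]
    simp only [hg] at this
    exact this
  -- Flipping the arms in `S` uses the new edge `ax` and frees `ay`.
  have hnear : y ::ₘ ((arms (M.map (Prod.map (flip S) (flip S)))).map firstOf).sum =
      x ::ₘ ((arms M).map firstOf).sum := by
    have h1 := hcancel firstOf (fun l => firstOf l.reverse) rfl (fun _ => rfl)
    apply add_right_cancel (b := ∑ l ∈ S, firstOf l)
    rw [Multiset.cons_add, h1, ← Multiset.add_cons, ← hS, Multiset.add_cons, Multiset.cons_add]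
  -- Correspondingly, the far ends lose `x` and gain `y`.
  have hfar : x ::ₘ ((arms (M.map (Prod.map (flip S) (flip S)))).map
      fun l => firstOf l.reverse).sum = y ::ₘ ((arms M).map fun l => firstOf l.reverse).sum := by
    have h1 := hcancel (fun l => firstOf l.reverse) firstOf rfl (fun l => by simp)
    apply add_right_cancel (b := ∑ l ∈ S, firstOf l.reverse)
    rw [Multiset.cons_add, h1, ← Multiset.add_cons, hS, Multiset.add_cons, Multiset.cons_add]
  have hfar' : x ::ₘ allEnds ((M.map (Prod.map (flip S) (flip S))).map (through a)) =
      y ::ₘ allEnds (M.map (through a)) := by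
    rw [allEnds_map_through, allEnds_map_through]
    simp only [firstOf_reverse_append, Multiset.sum_map_add]
    rw [← Multiset.cons_add, hfar, Multiset.cons_add]
    congr 3
    rw [arms_map_flip, Multiset.map_map]
    congr 2
    funext l
    simp [List.isEmpty_iff, flip_eq_nil]
  obtain ⟨N', rfl⟩ := Multiset.exists_cons_of_mem hlN
  -- The list `l` avoids `a` and ends at `y`; reverse it if necessary so that it starts at `y`.
  obtain ⟨t, ht, hte, htp⟩ : ∃ t, (∀ v, v ∈ y :: t ↔ v ∈ l) ∧ ends (y :: t) = ends l ∧
      pathEdges (y :: t) = pathEdges l ∧ (l.Nodup → (y :: t).Nodup) := by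
    rcases Multiset.mem_add.1 hyl with h | h
    · obtain ⟨t, rfl⟩ := exists_cons_of_mem_firstOf h
      exact ⟨t, fun _ => Iff.rfl, rfl, rfl, id⟩
    · obtain ⟨t, ht⟩ := exists_cons_of_mem_firstOf h
      refine ⟨t, ?_, ?_, ?_, ?_⟩
      · simp [← ht]
      · rw [← ht, ends_reverse]
      · rw [← ht, pathEdges_reverse]
      · rw [← ht, List.nodup_reverse]; exact id
  -- The freed edge `ay` extends `l` to `a`, replacing an end `y` by `a`; with the flips, the net
  -- effect is to replace an end `x` by `a`.
  refine ⟨(a :: y :: t) ::ₘ N' + (M.map (Prod.map (flip S) (flip S))).map (through a),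
    ?_, ?_, ?_⟩
  · intro m hm
    rcases Multiset.mem_add.1 hm with hm | hm
    · rcases Multiset.mem_cons.1 hm with rfl | hm
      · refine ⟨by simp, List.nodup_cons.2 ⟨?_, htp.2 ?_⟩⟩
        · rw [ht]
          exact hN l (by simp)
        · exact (hD l (by simp)).2
      · exact hD m (by simp [hm])
    · rw [Multiset.map_map] at hm
      obtain ⟨pq, hpq, rfl⟩ := Multiset.mem_map.1 hm
      exact ⟨by simp [through], nodup_through_flip S (hMnd pq hpq)⟩
  · have h1 := congrArg (Multiset.map fun v => s(a, v)) hnear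
    simp only [Multiset.map_cons] at h1
    rw [allEdges_add, allEdges_cons, allEdges_map_through, arms_map_flip, allEdges_map_flip,
      allEdges_add, allEdges_cons, allEdges_map_through, pathEdges_cons, htp.1]
    rw [arms_map_flip] at h1
    simp only [← Multiset.singleton_add] at h1 ⊢
    simp only [firstOf_cons, Multiset.map_singleton]
    calc _ = (pathEdges l + allEdges N' + allEdges (arms M)) + ({s(a, y)} +
        (((arms M).map (flip S)).map firstOf).sum.map (fun v => s(a, v))) := by abel
      _ = _ := by rw [h1]; abel
  · have h2 : y ::ₘ ends (a :: y :: t) = a ::ₘ ends (y :: t) := by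
      rcases List.eq_nil_or_concat t with rfl | ⟨u, b, rfl⟩
      · simp [ends, Multiset.cons_swap]
      · simp [ends, Multiset.cons_swap]
    rw [hte] at h2
    rw [← Multiset.cons_inj_right y]
    simp only [allEnds_add, allEnds_cons]
    simp only [← Multiset.singleton_add] at h2 hfar' ⊢
    calc _ = ({y} + ends (a :: y :: t)) + allEnds N' + ({x} +
        allEnds ((M.map (Prod.map (flip S) (flip S))).map (through a))) := by abel
      _ = _ := by rw [h2, hfar']; abel

/-! ### Path decompositions with prescribed ends, by induction on edges -/

lemma eq_singleton_or_exists_edge_of_mem_firstOf {l : List V} {v : V} (h : v ∈ firstOf l) :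
    l = [v] ∨ ∃ u, s(v, u) ∈ pathEdges l := by
  obtain ⟨t, rfl⟩ := exists_cons_of_mem_firstOf h
  cases t with
  | nil => exact Or.inl rfl
  | cons u t => exact Or.inr ⟨u, by simp⟩

lemma eq_singleton_or_exists_edge_of_mem_ends {l : List V} {v : V} (h : v ∈ ends l) :
    l = [v] ∨ ∃ u, s(v, u) ∈ pathEdges l := by
  rcases Multiset.mem_add.1 h with h | h
  · exact eq_singleton_or_exists_edge_of_mem_firstOf h
  · have := eq_singleton_or_exists_edge_of_mem_firstOf h
    rwa [pathEdges_reverse, List.reverse_eq_iff] at this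

lemma allEnds_eq (D : Multiset (List V)) :
    allEnds D = (D.map firstOf).sum + (D.map fun l => firstOf l.reverse).sum := by
  exact Multiset.sum_map_add

lemma mem_allEdges {D : Multiset (List V)} {e : Sym2 V} :
    e ∈ allEdges D ↔ ∃ l ∈ D, e ∈ pathEdges l := mem_sum_map

lemma mem_allEnds {D : Multiset (List V)} {v : V} :
    v ∈ allEnds D ↔ ∃ l ∈ D, v ∈ ends l := mem_sum_map

lemma singleton_mem_of_isolated {D : Multiset (List V)} {v : V} (h : v ∈ allEnds D)
    (hv : ∀ u, s(v, u) ∉ allEdges D) : [v] ∈ D := by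
  obtain ⟨l, hl, hvl⟩ := mem_allEnds.1 h
  rcases eq_singleton_or_exists_edge_of_mem_ends hvl with rfl | ⟨u, hu⟩
  · exact hl
  · exact absurd (mem_allEdges.2 ⟨l, hl, hu⟩) (hv u)

section degree
variable [DecidableEq V]

/-- The number of edges of `E` at `v`. -/
def edgeDegree (E : Finset (Sym2 V)) (v : V) : ℕ := (E.filter (v ∈ ·)).card

lemma edgeDegree_eq_erase {E : Finset (Sym2 V)} {e : Sym2 V} (he : e ∈ E) (v : V) :
    edgeDegree E v = edgeDegree (E.erase e) v + if v ∈ e then 1 else 0 := by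
  conv_lhs => rw [← Finset.insert_erase he]
  unfold edgeDegree
  rw [Finset.filter_insert]
  split_ifs with h
  · rw [Finset.card_insert_of_notMem (by simp)]
  · rfl

/-- Removing an edge toggles the parity exactly at the vertices on it. -/
lemma odd_edgeDegree_erase {E : Finset (Sym2 V)} {e : Sym2 V} (he : e ∈ E) (v : V) :
    Odd (edgeDegree (E.erase e) v) ↔ (Odd (edgeDegree E v) ↔ v ∉ e) := by
  rw [edgeDegree_eq_erase he v]
  split_ifs with h
  · simp [h, Nat.odd_add_one]
  · simp [h]

/-- `E` decomposes into paths of which exactly `T v` ends are at `v`. -/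
def HasPaths (E : Finset (Sym2 V)) (T : V → ℕ) : Prop :=
  ∃ D, IsPaths D ∧ allEdges D = E.val ∧ ∀ v, (allEnds D).count v = T v

/-- Move the odd vertex `w` to `t` by adding the edge between them. -/
lemma HasPaths.move {E : Finset (Sym2 V)} {t s w : V} (hts : t ≠ s) (hw : w ≠ s) (hwt : w ≠ t)
    (he : s(t, w) ∈ E)
    (h : HasPaths (E.erase s(t, w)) fun v => if v = w ∨ v = s then 1 else 2) :
    HasPaths E fun v => if v = t ∨ v = s then 1 else 2 := by
  obtain ⟨D, hD, hE, hT⟩ := h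
  have hE' : s(w, t) ::ₘ allEdges D = E.val := by
    rw [hE, Finset.erase_val, Sym2.eq_swap, Multiset.cons_erase he]
  obtain ⟨D', hD', hED', hTD'⟩ := exists_add_edge hD hwt.symm (hE' ▸ E.nodup)
    (fun v _ => by
      rw [← Multiset.count_pos, hT]
      dsimp only
      split_ifs <;> omega)
  refine ⟨D', hD', hED'.trans hE', fun v => ?_⟩
  have h1 := congrArg (Multiset.count v) hTD'
  rw [Multiset.count_cons, Multiset.count_cons, hT] at h1
  grind

/-- An edge set with at most two vertices of odd degree decomposes into paths such that odd
vertices are ends once, and all others twice. -/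
theorem hasPaths_of_parity [Fintype V] (n : ℕ) (E : Finset (Sym2 V)) (hn : E.card = n)
    (hE : ∀ v, s(v, v) ∉ E) :
    ((∀ v, ¬ Odd (edgeDegree E v)) → HasPaths E fun _ => 2) ∧
    ∀ t s, t ≠ s → (∀ v, Odd (edgeDegree E v) ↔ v = t ∨ v = s) →
      HasPaths E fun v => if v = t ∨ v = s then 1 else 2 := by
  induction n generalizing E with
  | zero =>
    obtain rfl := Finset.card_eq_zero.1 hn
    -- Without edges, take the trivial path at each vertex; it ends there twice.
    refine ⟨fun _ => ⟨Finset.univ.val.map fun v => [v], ?_, ?_, ?_⟩, ?_⟩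
    · simp [IsPaths]
    · simp [allEdges]
    · intro v
      have : allEnds (Finset.univ.val.map fun v : V => [v]) =
          Finset.univ.val + Finset.univ.val := by
        rw [allEnds_eq]
        simp [Multiset.map_map, Function.comp_def]
      rw [this, Multiset.count_add, Multiset.count_eq_one_of_mem Finset.univ.nodup (by simp)]
    · intro t s _ h
      exact absurd ((h t).2 (Or.inl rfl)) (by simp [edgeDegree])
  | succ n ih =>
    have ih' : ∀ e ∈ E, _ := fun e he => ih (E.erase e)
      (by rw [Finset.card_erase_of_mem he, hn]; rfl) (fun v hv => hE v (Finset.mem_of_mem_erase hv))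
    constructor
    · intro heven
      obtain ⟨e, he⟩ : E.Nonempty := Finset.card_pos.1 (by omega)
      induction e using Sym2.ind with
      | _ a x =>
        have hax : a ≠ x := by rintro rfl; exact hE a he
        obtain ⟨D, hD, hDE, hDT⟩ := (ih' _ he).2 a x hax (fun v => by
          rw [odd_edgeDegree_erase he, Sym2.mem_iff]
          grind)
        refine ⟨[a, x] ::ₘ D, ?_, ?_, fun v => ?_⟩
        · intro l hl
          rcases Multiset.mem_cons.1 hl with rfl | hl
          · simp [hax]
          · exact hD l hl
        · rw [allEdges_cons, hDE, Finset.erase_val]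
          simpa using Multiset.cons_erase he
        · rw [allEnds_cons, Multiset.count_add, hDT]
          simp only [ends, List.reverse_cons, List.reverse_nil, List.nil_append, List.cons_append,
            firstOf_cons, Multiset.count_add, Multiset.count_singleton]
          grind
    · intro t s hts hodd
      by_cases h1 : ∃ w, w ≠ s ∧ s(t, w) ∈ E
      · obtain ⟨w, hws, he⟩ := h1
        have hwt : w ≠ t := by rintro rfl; exact hE _ he
        -- Removing `tw` moves the odd vertex from `t` to `w`.
        refine HasPaths.move hts hws hwt he ((ih' _ he).2 w s hws fun v => ?_)
        rw [odd_edgeDegree_erase he, hodd, Sym2.mem_iff]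
        grind
      by_cases h2 : ∃ w, w ≠ t ∧ s(s, w) ∈ E
      · obtain ⟨w, hwt, he⟩ := h2
        have hws : w ≠ s := by rintro rfl; exact hE _ he
        have := HasPaths.move hts.symm hwt hws he ((ih' _ he).2 w t hwt fun v => by
          rw [odd_edgeDegree_erase he, hodd, Sym2.mem_iff]
          grind)
        simpa only [or_comm] using this
      push Not at h1 h2
      -- No other edge remains possible at `t`, whose degree is odd and so positive.
      have he : s(t, s) ∈ E := by
        have hpos : 0 < edgeDegree E t := ((hodd t).2 (Or.inl rfl)).pos
        obtain ⟨e, he⟩ := Finset.card_pos.1 hpos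
        rw [Finset.mem_filter] at he
        obtain ⟨u, rfl⟩ := Sym2.mem_iff_exists.1 he.2
        by_cases hu : u = s
        · exact hu ▸ he.1
        · exact absurd he.1 (h1 u hu)
      obtain ⟨D, hD, hDE, hDT⟩ := (ih' _ he).1 (fun v => by
        rw [odd_edgeDegree_erase he, hodd, Sym2.mem_iff]
        grind)
      have hmem : ∀ v, v ∈ allEnds D := fun v => by
        rw [← Multiset.count_pos, hDT]
        exact two_pos
      -- Without the edge `ts`, both `t` and `s` are isolated, so the paths ending there are
      -- trivial. The edge joins these two trivial paths into one.
      have ht : [t] ∈ D := singleton_mem_of_isolated (hmem t) (by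
        intro u hu
        rw [hDE, Finset.mem_val, Finset.mem_erase] at hu
        by_cases h : u = s
        · exact hu.1 (by rw [h])
        · exact h1 u h hu.2)
      have hs : [s] ∈ D := singleton_mem_of_isolated (hmem s) (by
        intro u hu
        rw [hDE, Finset.mem_val, Finset.mem_erase] at hu
        by_cases h : u = t
        · exact hu.1 (by rw [h, Sym2.eq_swap])
        · exact h2 u h hu.2)
      obtain ⟨D, rfl⟩ := Multiset.exists_cons_of_mem ht
      have hs : [s] ∈ D := (Multiset.mem_cons.1 hs).resolve_left (by simpa using hts.symm)
      obtain ⟨D, rfl⟩ := Multiset.exists_cons_of_mem hs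
      refine ⟨[t, s] ::ₘ D, ?_, ?_, fun v => ?_⟩
      · intro l hl
        rcases Multiset.mem_cons.1 hl with rfl | hl
        · simp [hts]
        · exact hD l (by simp [hl])
      · simp only [allEdges_cons, pathEdges_cons, firstOf_nil, pathEdges_nil, Multiset.map_zero,
          zero_add, Finset.erase_val] at hDE
        rw [allEdges_cons, hDE]
        simpa using Multiset.cons_erase he
      · have := hDT v
        simp only [allEnds_cons, ends, List.reverse_cons, List.reverse_nil, List.nil_append,
          List.cons_append, firstOf_cons, Multiset.count_add, Multiset.count_singleton] at this ⊢
        grind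

end degree

/-! ### Orienting the paths so that their ends form a permutation -/

/-- Every finite multigraph with even degrees has an orientation with equal in- and outdegrees. -/
theorem exists_balanced_orientation [DecidableEq V] (n : ℕ) (P : Multiset (V × V))
    (hn : P.card = n)
    (hP : ∀ v, Even ((P.map Prod.fst + P.map Prod.snd).count v)) :
    ∃ P', Multiset.Rel (fun p q : V × V => q = p ∨ q = p.swap) P P' ∧
      P'.map Prod.fst = P'.map Prod.snd := by
  induction n using Nat.strong_induction_on generalizing P with
  | _ n ih =>
    subst hn
    induction P using Multiset.induction with
    | empty => exact ⟨0, Multiset.Rel.zero, rfl⟩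
    | cons p Q _ =>
      obtain ⟨u, v⟩ := p
      by_cases huv : u = v
      · subst huv
        obtain ⟨Q', h1, h2⟩ := ih Q.card (by simp) Q rfl (fun w => by
          have := hP w
          simp only [Multiset.map_cons, Multiset.count_add, Multiset.count_cons] at this ⊢
          split_ifs at this <;> grind)
        exact ⟨(u, u) ::ₘ Q', Multiset.Rel.cons (Or.inl rfl) h1, by simp [h2]⟩
      -- The first pair contributes one end at `v` since `u ≠ v`, so evenness forces another.
      · have hv : v ∈ Q.map Prod.fst + Q.map Prod.snd := by
          rw [← Multiset.count_pos]
          have := hP v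
          simp only [Multiset.map_cons, Multiset.count_add, Multiset.count_cons, Ne.symm huv,
            if_false, if_true] at this ⊢
          grind
        obtain ⟨w, r, hr, hrw⟩ : ∃ w, ∃ r ∈ Q, r = (v, w) ∨ r = (w, v) := by
          rcases Multiset.mem_add.1 hv with h | h <;>
          obtain ⟨r, hr, rfl⟩ := Multiset.mem_map.1 h
          · exact ⟨r.2, r, hr, Or.inl rfl⟩
          · exact ⟨r.1, r, hr, Or.inr rfl⟩
        obtain ⟨Q, rfl⟩ := Multiset.exists_cons_of_mem hr
        -- Shortcut `uv`, `vw` to `uw`, which preserves all parities. Either orientation of `uw`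
        -- lifts to one of the two edges that enters and leaves `v` once.
        obtain ⟨P', h1, h2⟩ := ih ((u, w) ::ₘ Q).card (by simp) _ rfl (fun z => by
          have := hP z
          rcases hrw with rfl | rfl <;>
          simp only [Multiset.map_cons, Multiset.count_add, Multiset.count_cons] at this ⊢ <;>
          grind)
        obtain ⟨r', Q', hr', hQ', rfl⟩ := Multiset.rel_cons_left.1 h1
        rcases hr' with rfl | rfl
        · refine ⟨(u, v) ::ₘ (v, w) ::ₘ Q', Multiset.Rel.cons (Or.inl rfl)
            (Multiset.Rel.cons ?_ hQ'), ?_⟩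
          · rcases hrw with rfl | rfl <;> simp
          · simp only [Multiset.map_cons] at h2 ⊢
            rw [Multiset.cons_swap, h2]
        · refine ⟨(v, u) ::ₘ (w, v) ::ₘ Q', Multiset.Rel.cons (Or.inr rfl)
            (Multiset.Rel.cons ?_ hQ'), ?_⟩
          · rcases hrw with rfl | rfl <;> simp
          · simp only [Multiset.map_cons, Prod.swap] at h2 ⊢
            rw [h2, Multiset.cons_swap]

/-- `l` is a list from `p.1` to `p.2`. -/
def Joins (l : List V) (p : V × V) : Prop := firstOf l = {p.1} ∧ firstOf l.reverse = {p.2}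

lemma exists_rel_joins {D : Multiset (List V)} (hD : IsPaths D) :
    ∃ P, Multiset.Rel Joins D P := by
  induction D using Multiset.induction with
  | empty => exact ⟨0, Multiset.Rel.zero⟩
  | cons l D ih =>
    obtain ⟨P, hP⟩ := ih fun l hl => hD l (Multiset.mem_cons_of_mem hl)
    have hl := (hD l (by simp)).1
    obtain ⟨u, -, hu⟩ := exists_firstOf_eq hl
    obtain ⟨v, -, hv⟩ := exists_firstOf_eq (l := l.reverse) (by simpa using hl)
    exact ⟨(u, v) ::ₘ P, Multiset.Rel.cons ⟨hu, hv⟩ hP⟩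

lemma heads_of_rel_joins {D : Multiset (List V)} {P : Multiset (V × V)}
    (h : Multiset.Rel Joins D P) :
    (D.map firstOf).sum = P.map Prod.fst ∧
      (D.map fun l => firstOf l.reverse).sum = P.map Prod.snd := by
  induction h with
  | zero => simp
  | cons h _ ih => simp [ih, h.1, h.2]

/-- Reversing a list swaps its start and finish but keeps its edges and its multiset of ends. -/
lemma exists_reorient {P P' : Multiset (V × V)}
    (h : Multiset.Rel (fun p q : V × V => q = p ∨ q = p.swap) P P') {D : Multiset (List V)}
    (hD : IsPaths D) (hDP : Multiset.Rel Joins D P) :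
    ∃ D', IsPaths D' ∧ allEdges D' = allEdges D ∧ allEnds D' = allEnds D ∧
      Multiset.Rel Joins D' P' := by
  induction h generalizing D with
  | zero => exact ⟨D, hD, rfl, rfl, hDP⟩
  | cons hpq _ ih =>
    obtain ⟨l, C, hl, hC, rfl⟩ := Multiset.rel_cons_right.1 hDP
    obtain ⟨C', h1, h2, h3, h4⟩ := ih (fun l hl => hD l (Multiset.mem_cons_of_mem hl)) hC
    have hl' := hD l (by simp)
    rcases hpq with rfl | rfl
    · refine ⟨l ::ₘ C', ?_, by simp [h2], by simp [h3], Multiset.Rel.cons hl h4⟩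
      intro m hm
      rcases Multiset.mem_cons.1 hm with rfl | hm
      · exact hl'
      · exact h1 m hm
    · refine ⟨l.reverse ::ₘ C', ?_, by simp [h2, pathEdges_reverse], by simp [h3, ends_reverse],
        Multiset.Rel.cons ⟨hl.2, by simpa using hl.1⟩ h4⟩
      intro m hm
      rcases Multiset.mem_cons.1 hm with rfl | hm
      · simpa using hl'
      · exact h1 m hm

lemma eq_of_nodup_sum_map {α β : Type*} {B : Multiset α} {f : α → Multiset β}
    (h : (B.map f).sum.Nodup) {l l' : α} (hl : l ∈ B) (hl' : l' ∈ B) {y : β} (hy : y ∈ f l)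
    (hy' : y ∈ f l') : l = l' := by
  by_contra hne
  obtain ⟨B, rfl⟩ := Multiset.exists_cons_of_mem hl
  rw [Multiset.map_cons, Multiset.sum_cons, Multiset.nodup_add] at h
  have : l' ∈ B := (Multiset.mem_cons.1 hl').resolve_left (Ne.symm hne)
  exact Multiset.disjoint_left.1 h.2.2 hy (mem_sum_map.2 ⟨l', this, hy'⟩)

/-- An edge set with even degrees decomposes into paths, one from each vertex `v`, the ends of
which form a permutation of the vertices. -/
theorem exists_paths_perm [Fintype V] [DecidableEq V] (E : Finset (Sym2 V))
    (hE : ∀ v, s(v, v) ∉ E) (heven : ∀ v, Even (edgeDegree E v)) :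
    ∃ (P : V → List V) (σ : Equiv.Perm V), (∀ v, (P v).Nodup ∧ Joins (P v) (v, σ v)) ∧
      ∑ v, pathEdges (P v) = E.val := by
  obtain ⟨D, hD, hDE, hDT⟩ := (hasPaths_of_parity _ E rfl hE).1
    fun v => Nat.not_odd_iff_even.2 (heven v)
  obtain ⟨Q, hDQ⟩ := exists_rel_joins hD
  have hQ := heads_of_rel_joins hDQ
  obtain ⟨Q', hQQ', hbal⟩ := exists_balanced_orientation _ Q rfl (fun v => by
    rw [← hQ.1, ← hQ.2, ← allEnds_eq, hDT]
    exact even_two)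
  obtain ⟨D', hD', hE', hT', hDQ'⟩ := exists_reorient hQQ' hD hDQ
  have hQ' := heads_of_rel_joins hDQ'
  -- Each vertex is an end twice, and equally often a start and a finish, hence a start once.
  have hheads : (D'.map firstOf).sum = Finset.univ.val := by
    ext v
    have h1 := hDT v
    rw [← hT', allEnds_eq, hQ'.1, hQ'.2, ← hbal, Multiset.count_add] at h1
    rw [Multiset.count_eq_one_of_mem Finset.univ.nodup (by simp), hQ'.1]
    grind
  have hlasts : (D'.map fun l => firstOf l.reverse).sum = Finset.univ.val := by
    rw [hQ'.2, ← hbal, ← hQ'.1, hheads]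
  have hnd : (D'.map firstOf).sum.Nodup := hheads ▸ Finset.univ.nodup
  have hDnd : D'.Nodup := nodup_of_nodup_sum_map (f := firstOf) (fun l hl => by
    obtain ⟨y, -, hy⟩ := exists_firstOf_eq (hD' l hl).1
    simp [hy]) hnd
  have hP : ∀ v, ∃ l ∈ D', firstOf l = {v} := fun v => by
    have : v ∈ (D'.map firstOf).sum := by simp [hheads]
    obtain ⟨l, hl, hv⟩ := mem_sum_map.1 this
    obtain ⟨t, rfl⟩ := exists_cons_of_mem_firstOf hv
    exact ⟨_, hl, rfl⟩
  choose P hPD hPv using hP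
  have hσ : ∀ v, ∃ w, firstOf (P v).reverse = {w} := fun v => by
    obtain ⟨w, -, hw⟩ := exists_firstOf_eq (l := (P v).reverse) (by simpa using (hD' _ (hPD v)).1)
    exact ⟨w, hw⟩
  choose σ hσ using hσ
  have hPinj : Function.Injective P := fun v w h => by
    have := (hPv v).symm.trans (h ▸ hPv w)
    simpa using this
  have hσinj : Function.Injective σ := fun v w h => hPinj <|
    eq_of_nodup_sum_map (f := fun l : List V => firstOf l.reverse)
      (hlasts ▸ Finset.univ.nodup) (hPD v) (hPD w) (y := σ v)
      (by simp [hσ]) (by simp [hσ, h])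
  refine ⟨P, Equiv.ofBijective σ (Finite.injective_iff_bijective.1 hσinj),
    fun v => ⟨(hD' _ (hPD v)).2, hPv v, hσ v⟩, ?_⟩
  have hDP : D' = Finset.univ.val.map P := by
    rw [Multiset.Nodup.ext hDnd (Finset.univ.nodup.map hPinj)]
    intro l
    simp only [Multiset.mem_map, Finset.mem_val, Finset.mem_univ, true_and]
    constructor
    · intro hl
      obtain ⟨y, -, hy⟩ := exists_firstOf_eq (hD' l hl).1
      exact ⟨y, eq_of_nodup_sum_map hnd (hPD y) hl (y := y) (by simp [hPv]) (by simp [hy])⟩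
    · rintro ⟨v, rfl⟩
      exact hPD v
  rw [← hDE, ← hE', hDP, allEdges, Multiset.map_map]
  rfl

/-! ### Threading the paths through the layers -/

variable {A : Type*}

lemma firstOf_map (f : V → A) (l : List V) : firstOf (l.map f) = (firstOf l).map f := by
  cases l <;> simp

lemma pathEdges_map (f : V → A) (l : List V) :
    pathEdges (l.map f) = (pathEdges l).map (Sym2.map f) := by
  induction l with
  | nil => rfl
  | cons h t ih => simp [ih, firstOf_map, Multiset.map_map, Function.comp_def]

lemma nodup_pathEdges {l : List V} (h : l.Nodup) : (pathEdges l).Nodup := by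
  induction l with
  | nil => simp
  | cons a t ih =>
    rw [List.nodup_cons] at h
    rw [pathEdges_cons, Multiset.nodup_add]
    refine ⟨?_, ih h.2, ?_⟩
    · cases t <;> simp
    · rw [Multiset.disjoint_left]
      intro e he he'
      obtain ⟨w, -, rfl⟩ := Multiset.mem_map.1 he
      exact h.1 (mem_of_mem_pathEdges he').1

lemma mem_pathEdges_iff_getElem {l : List V} {e : Sym2 V} :
    e ∈ pathEdges l ↔ ∃ (k : ℕ) (h : k + 1 < l.length), e = s(l[k], l[k + 1]) := by
  induction l with
  | nil => simp
  | cons a t ih =>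
    rw [pathEdges_cons, Multiset.mem_add, ih]
    constructor
    · rintro (h | ⟨k, hk, rfl⟩)
      · obtain ⟨w, hw, rfl⟩ := Multiset.mem_map.1 h
        obtain ⟨t, rfl⟩ := exists_cons_of_mem_firstOf hw
        exact ⟨0, by simp, by simp⟩
      · exact ⟨k + 1, by simpa using hk, by simp⟩
    · rintro ⟨k, hk, rfl⟩
      cases k with
      | zero =>
        left
        cases t with
        | nil => simp at hk
        | cons b t => simp
      | succ k => exact Or.inr ⟨k, by simpa using hk, by simp⟩

lemma mem_pathEdges_finRange {m : ℕ} {i j : Fin m} :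
    s(i, j) ∈ pathEdges (List.finRange m) ↔ (SimpleGraph.pathGraph m).Adj i j := by
  rw [mem_pathEdges_iff_getElem, SimpleGraph.pathGraph_adj]
  constructor
  · rintro ⟨k, hk, h⟩
    rw [Sym2.eq_iff] at h
    rcases h with ⟨rfl, rfl⟩ | ⟨rfl, rfl⟩ <;> simp
  · rintro (h | h)
    · refine ⟨i, by simp; omega, ?_⟩
      simp [h]
    · refine ⟨j, by simp; omega, ?_⟩
      simp [h, Sym2.eq_swap]

/-- Follow the path `P v` in the first layer, cross to the next layer at its end `σ v`, follow
`P (σ v)` there, and so on. -/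
def layered (P : V → List V) (σ : V → V) : List A → V → List (A × V)
  | [], _ => []
  | i :: is, v => (P v).map (Prod.mk i) ++ layered P σ is (σ v)

section layered
variable {P : V → List V} {σ : Equiv.Perm V}

lemma fst_mem_of_mem_layered {is : List A} {v : V} {x : A × V}
    (h : x ∈ layered P σ is v) : x.1 ∈ is := by
  induction is generalizing v with
  | nil => simp [layered] at h
  | cons i is ih =>
    rw [layered, List.mem_append] at h
    rcases h with h | h
    · obtain ⟨w, -, rfl⟩ := List.mem_map.1 h
      simp
    · exact List.mem_cons_of_mem _ (ih h)

lemma nodup_layered (hP : ∀ v, (P v).Nodup) {is : List A} (his : is.Nodup) (v : V) :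
    (layered P σ is v).Nodup := by
  induction is generalizing v with
  | nil => simp [layered]
  | cons i is ih =>
    rw [List.nodup_cons] at his
    rw [layered, List.nodup_append']
    refine ⟨(hP v).map (Prod.mk_right_injective i), ih his.2 _, ?_⟩
    intro x hx hx'
    obtain ⟨w, -, rfl⟩ := List.mem_map.1 hx
    exact his.1 (fst_mem_of_mem_layered hx')

lemma firstOf_layered (hP : ∀ v, Joins (P v) (v, σ v)) (is : List A) (v : V) :
    firstOf (layered P σ is v) = (firstOf is).map fun i => (i, v) := by
  cases is with
  | nil => rfl
  | cons i is =>
    obtain ⟨t, ht⟩ := exists_cons_of_mem_firstOf (l := P v) (v := v) (by simp [(hP v).1])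
    simp [layered, ht]

/-- As `v` varies, the lists enter each layer once at every vertex because `σ` is a permutation. So
every `P v` occurs once in each layer, and each column is crossed once between successive layers. -/
lemma sum_pathEdges_layered [Fintype V] (hP : ∀ v, Joins (P v) (v, σ v))
    {E : Multiset (Sym2 V)} (hE : ∑ v, pathEdges (P v) = E) (is : List A) :
    ∑ v, pathEdges (layered P σ is v) =
      ((is : Multiset A) ×ˢ E).map (fun x => x.2.map (Prod.mk x.1)) +
        (pathEdges is ×ˢ (Finset.univ : Finset V).val).map
          (fun x => x.1.map fun i => (i, x.2)) := by
  induction is with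
  | nil => simp [layered]
  | cons i is ih =>
    have h1 : ∀ v, pathEdges (layered P σ (i :: is) v) = (pathEdges (P v)).map (Sym2.map (Prod.mk i)) +
        (firstOf is).map (fun j => s((i, σ v), (j, σ v))) + pathEdges (layered P σ is (σ v)) := by
      intro v
      rw [layered, pathEdges_append, pathEdges_map, ← List.map_reverse, firstOf_map, (hP v).2,
        firstOf_layered hP]
      simp [Multiset.map_map]
    have h2 : ∑ v, (pathEdges (P v)).map (Sym2.map (Prod.mk i)) = E.map (Sym2.map (Prod.mk i)) := by
      rw [← hE]
      exact (map_sum (Multiset.mapAddMonoidHom (Sym2.map (Prod.mk i))) _ _).symm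
    have h3 : ∑ v, (firstOf is).map (fun j => s((i, v), (j, v))) =
        (((firstOf is).map fun j => s(i, j)) ×ˢ (Finset.univ : Finset V).val).map
          (fun x => x.1.map fun i => (i, x.2)) := by
      cases is with
      | nil => simp
      | cons j is =>
        have key := Multiset.sum_map_singleton
          ((Finset.univ : Finset V).val.map fun v => s((i, v), (j, v)))
        rw [Multiset.map_map] at key
        rw [firstOf_cons, Multiset.map_singleton, ← Multiset.cons_zero s(i, j),
          Multiset.cons_product, Multiset.zero_product, add_zero, Multiset.map_map]
        exact key
    simp only [h1, Finset.sum_add_distrib, h2]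
    rw [Equiv.sum_comp σ (fun v => (firstOf is).map (fun j => s((i, v), (j, v)))),
      Equiv.sum_comp σ (fun v => pathEdges (layered P σ is v)), ih, h3, pathEdges_cons,
      ← Multiset.cons_coe, Multiset.cons_product, Multiset.add_product, Multiset.map_add,
      Multiset.map_add, Multiset.map_map]
    simp only [Function.comp_def]
    abel

end layered

/-- The two projections of an edge in a layer recover it: one gives the original edge, the other the
layer as a diagonal pair. -/
lemma nodup_map_layer {E : Multiset (Sym2 V)} {I : Multiset A} (hE : E.Nodup) (hI : I.Nodup) :
    ((I ×ˢ E).map fun x => x.2.map (Prod.mk x.1)).Nodup := by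
  refine (Multiset.Nodup.product hI hE).map ?_
  rintro ⟨i, e⟩ ⟨j, f⟩ h
  have h1 := congrArg (Sym2.map Prod.snd) h
  have h2 := congrArg (Sym2.map Prod.fst) h
  simp only [Sym2.map_map, Function.comp_def] at h1 h2
  induction e using Sym2.ind
  induction f using Sym2.ind
  simp_all

lemma nodup_map_column {E : Multiset (Sym2 A)} {I : Multiset V} (hE : E.Nodup) (hI : I.Nodup) :
    ((E ×ˢ I).map fun x => x.1.map fun i => (i, x.2)).Nodup := by
  refine (Multiset.Nodup.product hE hI).map ?_
  rintro ⟨e, i⟩ ⟨f, j⟩ h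
  have h1 := congrArg (Sym2.map Prod.snd) h
  have h2 := congrArg (Sym2.map Prod.fst) h
  simp only [Sym2.map_map, Function.comp_def] at h1 h2
  induction e using Sym2.ind
  induction f using Sym2.ind
  simp_all

/-! ### From lists to path decompositions of graphs, and the lower bound -/

section bridge
open SimpleGraph

lemma coe_edges_eq_pathEdges {G : SimpleGraph V} {u v : V} (w : G.Walk u v) :
    (w.edges : Multiset (Sym2 V)) = pathEdges w.support := by
  induction w with
  | nil => simp
  | cons h p ih =>
    rw [Walk.edges_cons, Walk.support_cons, pathEdges_cons, ← ih, ← Multiset.cons_coe]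
    cases p <;> simp

lemma isChain_adj {G : SimpleGraph V} {l : List V} (h : ∀ e ∈ pathEdges l, e ∈ G.edgeSet) :
    l.IsChain G.Adj := by
  rw [List.isChain_iff_getElem]
  intro k hk
  exact h _ (mem_pathEdges_iff_getElem.2 ⟨k, hk, rfl⟩)

lemma exists_isPathSubgraph {G : SimpleGraph V} {l : List V} (hne : l ≠ []) (hl : l.Nodup)
    (h : ∀ e ∈ pathEdges l, e ∈ G.edgeSet) :
    ∃ P : G.Subgraph, P.IsPathSubgraph ∧ ∀ e, e ∈ P.edgeSet ↔ e ∈ pathEdges l := by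
  let w := Walk.ofSupport l hne (isChain_adj h)
  have hw : w.support = l := Walk.support_ofSupport hne _
  refine ⟨w.toSubgraph, ⟨_, _, w, by rw [Walk.isPath_def, hw]; exact hl, rfl⟩, fun e => ?_⟩
  rw [Walk.mem_edges_toSubgraph, ← Multiset.mem_coe, coe_edges_eq_pathEdges, hw]

/-- A family of lists which partition the edges of a graph gives a path decomposition. -/
theorem pathNumber_le_of_lists {ι : Type*} [Fintype ι] {G : SimpleGraph V} (L : ι → List V)
    (hne : ∀ i, L i ≠ []) (hL : ∀ i, (L i).Nodup) (hnd : (∑ i, pathEdges (L i)).Nodup)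
    (hG : ∀ e, e ∈ ∑ i, pathEdges (L i) ↔ e ∈ G.edgeSet) : G.pathNumber ≤ Fintype.card ι := by
  classical
  have hsub : ∀ i, ∀ e ∈ pathEdges (L i), e ∈ G.edgeSet := fun i e he =>
    (hG e).1 (Multiset.mem_sum.2 ⟨i, Finset.mem_univ i, he⟩)
  choose P hP hPe using fun i => exists_isPathSubgraph (hne i) (hL i) (hsub i)
  have hdec : G.IsPathDecomposition (Finset.univ.image P) := by
    refine ⟨?_, ?_, ?_⟩
    · intro Q hQ
      obtain ⟨i, -, rfl⟩ := Finset.mem_image.1 hQ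
      exact hP i
    · intro Q hQ R hR hQR
      obtain ⟨i, -, rfl⟩ := Finset.mem_image.1 hQ
      obtain ⟨j, -, rfl⟩ := Finset.mem_image.1 hR
      rw [Set.disjoint_left]
      intro e hi hj
      rw [hPe] at hi hj
      have hij : i = j := eq_of_nodup_sum_map (B := Finset.univ.val)
        (f := fun i => pathEdges (L i)) hnd (by simp) (by simp) hi hj
      exact hQR (by rw [hij])
    · intro e he
      obtain ⟨i, -, hi⟩ := Multiset.mem_sum.1 ((hG e).2 he)
      exact ⟨P i, Finset.mem_image_of_mem P (Finset.mem_univ i), (hPe i e).2 hi⟩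
  -- Different indices may give the same trivial path, so the image can have fewer members than the
  -- family.
  have hle : G.pathNumber ≤ (Finset.univ.image P).card := Nat.sInf_le ⟨_, hdec, rfl⟩
  exact hle.trans Finset.card_image_le

lemma degree_eq_edgeDegree [Fintype V] [DecidableEq V] (G : SimpleGraph V) [DecidableRel G.Adj]
    (v : V) : G.degree v = edgeDegree G.edgeFinset v := by
  rw [← card_incidenceFinset_eq_degree, incidenceFinset_eq_filter, edgeDegree]

-- A path enters and leaves each inner vertex, so only its two ends can see an odd number of its
-- edges.
open Classical in
lemma exists_ends_of_isPathSubgraph [Fintype V] {G : SimpleGraph V} {P : G.Subgraph}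
    (hP : P.IsPathSubgraph) : ∃ T : Finset V, T.card ≤ 2 ∧
      ∀ v ∉ T, Even (G.edgeFinset.filter fun e => v ∈ e ∧ e ∈ P.edgeSet).card := by
  obtain ⟨a, b, w, hw, rfl⟩ := hP
  refine ⟨{a, b}, Finset.card_le_two, fun v hv => ?_⟩
  simp only [Finset.mem_insert, Finset.mem_singleton, not_or] at hv
  have h1 := (hw.isTrail.even_countP_edges_iff v).2 fun _ => hv
  rw [List.countP_eq_length_filter, ← List.toFinset_card_of_nodup
    (hw.isTrail.edges_nodup.filter _)] at h1
  convert h1 using 2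
  ext e
  simp only [Finset.mem_filter, mem_edgeFinset, Walk.mem_edges_toSubgraph, List.mem_toFinset,
    List.mem_filter, decide_eq_true_eq]
  exact ⟨fun h => ⟨h.2.2, h.2.1⟩, fun h => ⟨w.edges_subset_edgeSet h.1, h.2, h.1⟩⟩

/-- Every vertex of odd degree is an end of some path of a decomposition. -/
theorem numOddVertices_le [Fintype V] {G : SimpleGraph V} {D : Finset G.Subgraph}
    (hD : G.IsPathDecomposition D) : G.numOddVertices ≤ D.card * 2 := by
  classical
  choose! T hT heven using fun P (hP : P ∈ D) => exists_ends_of_isPathSubgraph (hD.isPath P hP)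
  have hsub : (Finset.univ.filter fun v : V => Odd (G.degree v)) ⊆ D.biUnion T := by
    intro v hv
    by_contra hv'
    simp only [Finset.mem_biUnion, not_exists, not_and] at hv'
    refine Nat.not_even_iff_odd.2 (Finset.mem_filter.1 hv).2 ?_
    -- If `v` is an end of no path, its edges split into even classes, one for each path.
    have hE : G.edgeFinset.filter (v ∈ ·) =
        D.biUnion fun P => G.edgeFinset.filter fun e => v ∈ e ∧ e ∈ P.edgeSet := by
      ext e
      simp only [Finset.mem_filter, mem_edgeFinset, Finset.mem_biUnion]
      constructor
      · rintro ⟨he, hve⟩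
        obtain ⟨P, hPD, heP⟩ := hD.covers e he
        exact ⟨P, hPD, he, hve, heP⟩
      · rintro ⟨P, -, he, hve, -⟩
        exact ⟨he, hve⟩
    rw [degree_eq_edgeDegree, edgeDegree, hE, Finset.card_biUnion]
    · exact Finset.even_sum _ fun P hPD => heven P hPD v (hv' P hPD)
    · intro P hPD Q hQD hPQ
      refine Finset.disjoint_left.2 fun e he he' => ?_
      exact Set.disjoint_left.1 (hD.edgeDisjoint P hPD Q hQD hPQ)
        (Finset.mem_filter.1 he).2.2 (Finset.mem_filter.1 he').2.2
  calc G.numOddVertices ≤ (D.biUnion T).card := Finset.card_le_card hsub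
    _ ≤ D.card * 2 := Finset.card_biUnion_le_card_mul _ _ _ hT

/-! ### Parities in the product and the upper bound -/

/-- Each end of the path lacks one of two possible neighbours; `2 ≤ m` prevents a vertex from being
both ends, which would make its degree zero. -/
lemma odd_degree_pathGraph {m : ℕ} (hm : 2 ≤ m) (i : Fin m)
    [Fintype ((pathGraph m).neighborSet i)] :
    Odd ((pathGraph m).degree i) ↔ i.val = 0 ∨ i.val + 1 = m := by
  classical
  have h1 : (pathGraph m).neighborFinset i =
      (Finset.univ.filter fun j : Fin m => j.val + 1 = i.val) ∪
        (Finset.univ.filter fun j : Fin m => i.val + 1 = j.val) := by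
    ext j
    simp [pathGraph_adj, or_comm]
  have hl : (Finset.univ.filter fun j : Fin m => j.val + 1 = i.val).card =
      if i.val = 0 then 0 else 1 := by
    split_ifs with h
    · simp [h]
    · rw [Finset.card_eq_one]
      refine ⟨⟨i - 1, by omega⟩, ?_⟩
      ext j
      simp only [Finset.mem_filter, Finset.mem_univ, true_and, Finset.mem_singleton, Fin.ext_iff]
      omega
  have hr : (Finset.univ.filter fun j : Fin m => i.val + 1 = j.val).card =
      if i.val + 1 = m then 0 else 1 := by
    split_ifs with h
    · rw [Finset.card_eq_zero, Finset.filter_eq_empty_iff]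
      intro j _
      omega
    · rw [Finset.card_eq_one]
      refine ⟨⟨i + 1, by omega⟩, ?_⟩
      ext j
      simp only [Finset.mem_filter, Finset.mem_univ, true_and, Finset.mem_singleton, Fin.ext_iff]
      omega
  rw [← card_neighborFinset_eq_degree, h1, Finset.card_union_of_disjoint, hl, hr]
  · split_ifs <;> simp_all
    omega
  · rw [Finset.disjoint_filter]
    intro j _
    omega

theorem numOddVertices_pathGraph_boxProd [Fintype V] (H : SimpleGraph V) [DecidableRel H.Adj]
    (hH : ∀ v, Even (H.degree v)) {m : ℕ} (hm : 2 ≤ m) :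
    (pathGraph m □ H).numOddVertices = 2 * Fintype.card V := by
  classical
  have h : (Finset.univ.filter fun x : Fin m × V => Odd ((pathGraph m □ H).degree x)) =
      ({⟨0, by omega⟩, ⟨m - 1, by omega⟩} : Finset (Fin m)) ×ˢ Finset.univ := by
    ext ⟨i, v⟩
    have hv := hH v
    simp only [Finset.mem_filter, Finset.mem_univ, true_and, Finset.mem_product, and_true,
      Finset.mem_insert, Finset.mem_singleton, Fin.ext_iff]
    rw [degree_boxProd]
    refine (Nat.odd_add.trans (iff_true_right (by convert hv))).trans ?_
    rw [odd_degree_pathGraph hm]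
    dsimp only
    omega
  have h2 : ({⟨0, by omega⟩, ⟨m - 1, by omega⟩} : Finset (Fin m)).card = 2 := by
    rw [Finset.card_pair]
    simp only [ne_eq, Fin.mk.injEq]
    omega
  unfold numOddVertices
  rw [← Finset.card_univ, ← h2, ← Finset.card_product, ← h]
  congr!

theorem pathNumber_pathGraph_boxProd_le [Fintype V] (H : SimpleGraph V) [DecidableRel H.Adj]
    (hH : ∀ v, Even (H.degree v)) {m : ℕ} (hm : m ≠ 0) :
    (pathGraph m □ H).pathNumber ≤ Fintype.card V := by
  classical
  obtain ⟨P, σ, hP, hE⟩ := exists_paths_perm H.edgeFinset (by simp)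
    (fun v => by rw [← degree_eq_edgeDegree]; exact hH v)
  have hsum := sum_pathEdges_layered (fun v => (hP v).2) hE (List.finRange m)
  have hnd := nodup_map_layer H.edgeFinset.nodup (I := (List.finRange m : Multiset (Fin m)))
    (List.nodup_finRange m)
  have hnd' := nodup_map_column (nodup_pathEdges (List.nodup_finRange m))
    (Finset.univ : Finset V).nodup
  have hmem1 : ∀ i j : Fin m, ∀ u v : V, s((i, u), (j, v)) ∈
      (((List.finRange m : Multiset (Fin m)) ×ˢ H.edgeFinset.val).map
        fun x => x.2.map (Prod.mk x.1)) ↔ i = j ∧ H.Adj u v := by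
    intro i j u v
    simp only [Multiset.mem_map, Multiset.mem_product, Multiset.mem_coe, List.mem_finRange,
      true_and, Finset.mem_val, mem_edgeFinset]
    constructor
    · rintro ⟨⟨k, e⟩, he, h⟩
      induction e using Sym2.ind with
      | _ a b =>
        rw [Sym2.map_mk, Sym2.eq_iff] at h
        simp only [mem_edgeSet, Prod.mk.injEq] at he h
        rcases h with ⟨⟨rfl, rfl⟩, rfl, rfl⟩ | ⟨⟨rfl, rfl⟩, rfl, rfl⟩
        · exact ⟨rfl, he⟩
        · exact ⟨rfl, he.symm⟩
    · rintro ⟨rfl, h⟩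
      exact ⟨(i, s(u, v)), h, rfl⟩
  have hmem2 : ∀ i j : Fin m, ∀ u v : V, s((i, u), (j, v)) ∈
      ((pathEdges (List.finRange m) ×ˢ (Finset.univ : Finset V).val).map
        fun x => x.1.map fun i => (i, x.2)) ↔ u = v ∧ (pathGraph m).Adj i j := by
    intro i j u v
    simp only [Multiset.mem_map, Multiset.mem_product, Finset.mem_val, Finset.mem_univ, and_true]
    constructor
    · rintro ⟨⟨e, k⟩, he, h⟩
      induction e using Sym2.ind with
      | _ a b =>
        rw [Sym2.map_mk, Sym2.eq_iff] at h
        simp only [mem_pathEdges_finRange, Prod.mk.injEq] at he h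
        rcases h with ⟨⟨rfl, rfl⟩, rfl, rfl⟩ | ⟨⟨rfl, rfl⟩, rfl, rfl⟩
        · exact ⟨rfl, he⟩
        · exact ⟨rfl, he.symm⟩
    · rintro ⟨rfl, h⟩
      exact ⟨(s(i, j), u), mem_pathEdges_finRange.2 h, rfl⟩
  refine pathNumber_le_of_lists (layered P σ (List.finRange m)) ?_ ?_ ?_ ?_
  · intro v h
    -- The list of `v` starts at `v` in the first layer, which exists since `m ≠ 0`.
    have := firstOf_layered (fun v => (hP v).2) (List.finRange m) v
    rw [h] at this
    obtain ⟨m, rfl⟩ := Nat.exists_eq_succ_of_ne_zero hm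
    simp [List.finRange_succ] at this
  · exact nodup_layered (fun v => (hP v).1) (List.nodup_finRange m)
  · rw [hsum, Multiset.nodup_add]
    refine ⟨hnd, hnd', Multiset.disjoint_left.2 fun {e} h1 h2 => ?_⟩
    induction e using Sym2.ind with
    | _ x y =>
      rw [hmem1] at h1
      rw [hmem2, h1.1] at h2
      exact h2.2.ne rfl
  · intro e
    induction e using Sym2.ind with
    | _ x y =>
      rw [hsum, Multiset.mem_add, hmem1, hmem2, mem_edgeSet, boxProd_adj]
      tauto

end bridge

end PathLists

theorem theorem5p3 {V : Type*} [Fintype V] (H : SimpleGraph V)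
    [DecidableRel H.Adj] (hH : ∀ v : V, Even (H.degree v)) (m : ℕ) (hm : 2 ≤ m) :
    ((SimpleGraph.boxProd (SimpleGraph.pathGraph m) H).pathNumber : ℚ) =
        ((SimpleGraph.boxProd (SimpleGraph.pathGraph m) H).numOddVertices : ℚ) / 2 ∧
      ((SimpleGraph.boxProd (SimpleGraph.pathGraph m) H).numOddVertices : ℚ) / 2 =
        (Fintype.card V : ℚ) := by
  have hodd := PathLists.numOddVertices_pathGraph_boxProd H hH hm
  have hle := PathLists.pathNumber_pathGraph_boxProd_le H hH (m := m) (by omega)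
  obtain ⟨D, hD, hcard⟩ :=
    (SimpleGraph.boxProd (SimpleGraph.pathGraph m) H).exists_isPathDecomposition_card_eq_pathNumber
  have hge := PathLists.numOddVertices_le hD
  rw [hodd, hcard] at hge
  have heq : (SimpleGraph.boxProd (SimpleGraph.pathGraph m) H).pathNumber = Fintype.card V := by
    omega
  rw [heq, hodd]
  push_cast
  constructor <;> ring
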